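/- **Theorem 4.1 (all curvature invariants of a plane wave vanish).** Let $m\ge 0$ and let $g$ be a plane wave metric on $\mathbb R^{m+2}$ with coordinates $(u,v,x^1,\dots,x^m)$ (the classical, four-dimensional case being $m=2$). That is, $g$ satisfies one of the following two definitions. (a) $g = 2\,du\,dv + H(u,\mathbf x)\,du^2 + \sum_{i}(dx^i)^2$ with $H(u,\mathbf x)=\sum_{i,j=1}^{m} h_{ij}(u)\,x^i x^j$, where $h_{ij}=h_{ji}$ are smooth functions on $\mathbb R$. (b) $g = 2\,du\,dv + H(u,\mathbf x)\,du^2 + \sum_{i}(dx^i)^2$ with $H$ an arbitrary smooth function on $\mathbb R\times\mathbb R^m$, and there is a smooth, nowhere vanishing, null vector field $Z$ with $\nabla Z=0$ such that, with $Z_\perp=\{X : g(X,Z)=0\}$, the curvature satisfies $R(X,Y)=0$ for all $X,Y\in Z_\perp$ and $\nabla_X R=0$ for all $X\in Z_\perp$. Here $\nabla$ is the Levi-Civita connection of $g$ and $R$ its Riemann tensor. An *elementary scalar curvature invariant* of $g$ is a full contraction with the inverse metric of a tensor product $\nabla^{p_1}R\otimes\cdots\otimes\nabla^{p_r}R$,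 where $r\ge 1$, $p_1,\dots,p_r\ge 0$, $R=R_{\rho\sigma\mu\nu}$ is the covariant Riemann tensor, the total number of indices is even, the indices are arranged in any way into disjoint pairs, and each pair is contracted with $g^{\alpha\beta}$. A *scalar curvature invariant* of $g$ is a real polynomial without constant term in elementary ones. Then every scalar curvature invariant $J$ of $g$ vanishes identically: $J(x)=0$ for every $x\in\mathbb R^{m+2}$. -/

import Mathlib

open scoped ContDiff

noncomputable section

namespace PlaneWave

section Curvature

variable {ι : Type} [Fintype ι] [DecidableEq ι]

/-- A field of symmetric bilinear forms on the manifold `ι → ℝ`, given by its components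
`g x μ ν = g_{μν}(x)` in the standard coordinates. -/
abbrev MetricField (ι : Type) : Type := (ι → ℝ) → Matrix ι ι ℝ

/-- A covariant tensor field of rank `k` on `ι → ℝ`, given by its components:
`T idx x = T_{idx 0, …, idx (k-1)}(x)`. -/
abbrev TensorField (ι : Type) (k : ℕ) : Type := (Fin k → ι) → (ι → ℝ) → ℝ

/-- The partial derivative `∂_μ f`. -/
def pderiv (μ : ι) (f : (ι → ℝ) → ℝ) (x : ι → ℝ) : ℝ :=
  fderiv ℝ f x (Pi.single μ 1)

/-- The Christoffel symbols `Γ^ρ_{μν}` of the Levi-Civita connection of `g`. -/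
def christoffel (g : MetricField ι) (ρ μ ν : ι) (x : ι → ℝ) : ℝ :=
  (1 / 2) * ∑ σ, (g x)⁻¹ ρ σ *
    (pderiv μ (fun y => g y σ ν) x + pderiv ν (fun y => g y σ μ) x
      - pderiv σ (fun y => g y μ ν) x)

/-- The Riemann tensor `R^ρ_{σμν}`, the `ρ`-component of `R(∂_μ, ∂_ν) ∂_σ`. -/
def riemannUp (g : MetricField ι) (ρ σ μ ν : ι) (x : ι → ℝ) : ℝ :=
  pderiv μ (christoffel g ρ ν σ) x - pderiv ν (christoffel g ρ μ σ) x
    + ∑ l, (christoffel g ρ μ l x * christoffel g l ν σ x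
      - christoffel g ρ ν l x * christoffel g l μ σ x)

/-- The covariant Riemann tensor `R_{ρσμν} = g_{ρλ} R^λ_{σμν}`. -/
def riemann (g : MetricField ι) : TensorField ι 4 := fun idx x =>
  ∑ l, g x (idx 0) l * riemannUp g l (idx 1) (idx 2) (idx 3) x

/-- The covariant derivative of a covariant tensor field; the new index comes first:
`(∇T)_{μ ν₁ … ν_k} = ∂_μ T_{ν₁ … ν_k} - ∑_i Γ^l_{μ ν_i} T_{ν₁ … l … ν_k}`. -/
def covDeriv (g : MetricField ι) {k : ℕ} (T : TensorField ι k) : TensorField ι (k + 1) :=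
  fun idx x =>
    pderiv (idx 0) (T (Fin.tail idx)) x
      - ∑ i : Fin k, ∑ l : ι, christoffel g l (idx 0) (Fin.tail idx i) x
          * T (Function.update (Fin.tail idx) i l) x

/-- The `p`-th iterated covariant derivative `∇_{μ_p} … ∇_{μ_1} R_{ρσμν}`. -/
def nablaRiemann (g : MetricField ι) : (p : ℕ) → TensorField ι (4 + p)
  | 0 => riemann g
  | p + 1 => covDeriv g (nablaRiemann g p)

/-- The pattern of a full contraction of a product of covariant derivatives of the Riemann tensor:
there are `r ≥ 1` factors, the `j`-th factor is `∇^{order j} R`, with `4 + order j` index slots,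
and `pairing` arranges the set of all index slots of all factors into `N` disjoint pairs
(in particular the total number of slots is even). -/
structure ContractionPattern where
  r : ℕ
  r_pos : 0 < r
  order : Fin r → ℕ
  N : ℕ
  pairing : (Σ j : Fin r, Fin (4 + order j)) ≃ Fin N × Fin 2

/-- The elementary scalar curvature invariant with a given contraction pattern: in
`∇^{p₁}R ⊗ ⋯ ⊗ ∇^{p_r}R`, each pair of indices is contracted with the inverse metric. -/
def fullContraction (g : MetricField ι) (c : ContractionPattern) (x : ι → ℝ) : ℝ :=
  ∑ idx : (Σ j : Fin c.r, Fin (4 + c.order j)) → ι,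
    (∏ j : Fin c.r, nablaRiemann g (c.order j) (fun s => idx ⟨j, s⟩) x)
      * ∏ k : Fin c.N, (g x)⁻¹ (idx (c.pairing.symm (k, 0))) (idx (c.pairing.symm (k, 1)))

/-- A scalar curvature invariant of `g`: a real polynomial without constant term in the full
contractions of products of covariant derivatives of the Riemann tensor. -/
def IsScalarCurvatureInvariant (g : MetricField ι) (J : (ι → ℝ) → ℝ) : Prop :=
  J ∈ NonUnitalAlgebra.adjoin ℝ (Set.range (fullContraction g))

/-- The scalar product `g(X, Y)` at the point `x`. -/
def metricProd (g : MetricField ι) (x X Y : ι → ℝ) : ℝ :=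
  ∑ μ, ∑ ν, g x μ ν * X μ * Y ν

/-- `Z` is a covariantly constant null vector field: smooth, nontrivial (and, being parallel, hence
without zeros), null, and with `∇_μ Z^ν = ∂_μ Z^ν + Γ^ν_{μl} Z^l = 0`. -/
structure IsParallelNull (g : MetricField ι) (Z : (ι → ℝ) → ι → ℝ) : Prop where
  smooth : ContDiff ℝ ∞ Z
  ne_zero : ∀ x, Z x ≠ 0
  null : ∀ x, metricProd g x (Z x) (Z x) = 0
  parallel : ∀ x μ ν, pderiv μ (fun y => Z y ν) x + ∑ l, christoffel g ν μ l x * Z x l = 0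

/-- The wavefront is flat: `R` vanishes on `Z_⊥ ∧ Z_⊥`, that is, `R(X, Y) = 0` whenever `X` and `Y`
are orthogonal to `Z`. -/
def FlatWavefront (g : MetricField ι) (Z : (ι → ℝ) → ι → ℝ) : Prop :=
  ∀ x X Y : ι → ℝ, metricProd g x X (Z x) = 0 → metricProd g x Y (Z x) = 0 →
    ∀ ρ σ, ∑ μ, ∑ ν, X μ * Y ν * riemannUp g ρ σ μ ν x = 0

/-- `∇_X R = 0` for every `X` orthogonal to `Z`. -/
def CurvatureParallelAlong (g : MetricField ι) (Z : (ι → ℝ) → ι → ℝ) : Prop :=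
  ∀ x X : ι → ℝ, metricProd g x X (Z x) = 0 →
    ∀ idx : Fin 4 → ι, ∑ μ, X μ * covDeriv g (riemann g) (Fin.cons μ idx) x = 0

end Curvature

/-- The indices of the coordinates `(u, v, x¹, …, x^m)` of `ℝ^(m+2)`. -/
abbrev Coord (m : ℕ) : Type := Fin 2 ⊕ Fin m

/-- The metric `2 du dv + H(u, x¹, …, x^m) du² + (dx¹)² + ⋯ + (dx^m)²` on `ℝ^(m+2)`. -/
def ppMetric {m : ℕ} (H : ℝ → (Fin m → ℝ) → ℝ) : MetricField (Coord m) := fun p =>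
  Matrix.fromBlocks !![H (p (Sum.inl 0)) (fun i => p (Sum.inr i)), 1; 1, 0] 0 0 1

/-- The (Brinkmann) definition: `H` is a quadratic form in `x` with smooth `u`-dependent
coefficients. -/
def IsPlaneWave {m : ℕ} (g : MetricField (Coord m)) : Prop :=
  ∃ h : ℝ → Matrix (Fin m) (Fin m) ℝ,
    (∀ i j, ContDiff ℝ ∞ (fun u => h u i j)) ∧ (∀ u, (h u).IsSymm) ∧
    g = ppMetric (fun u x => ∑ i, ∑ j, h u i j * x i * x j)

/-- The covariant definition: a pp-wave, with smooth `H`, having a covariantly constant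
null vector field `Z` with flat wavefront for which `∇_X R = 0` for all `X` orthogonal to `Z`. -/
def IsCovariantPlaneWave {m : ℕ} (g : MetricField (Coord m)) : Prop :=
  (∃ H : ℝ → (Fin m → ℝ) → ℝ,
    ContDiff ℝ ∞ (fun q : ℝ × (Fin m → ℝ) => H q.1 q.2) ∧ g = ppMetric H) ∧
  ∃ Z : (Coord m → ℝ) → Coord m → ℝ,
    IsParallelNull g Z ∧ FlatWavefront g Z ∧ CurvatureParallelAlong g Z

end PlaneWave

end

namespace PlaneWave

/-! Both definitions put `g` in the form `ppMetric H`, and a count of indices does the rest. Only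
`g_{uu}` varies, and it does not depend on `v`; hence `∂_v` and `du` are parallel. It follows that
`R` has no components with a lower index `v`, and that each nonzero component has an index `u`;
`IsNullAligned.covDeriv` passes this to every `∇^p R`. In a contraction `g⁻¹` pairs `u` only with
`v`, so every term dies (`fullContraction_ppMetric`). No regularity of `H` enters. -/

theorem pderiv_const {ι : Type} [DecidableEq ι] (μ : ι) (c : ℝ) (x : ι → ℝ) :
    pderiv μ (fun _ => c) x = 0 := by
  simp [pderiv]

theorem pderiv_zero {ι : Type} [DecidableEq ι] (μ : ι) (x : ι → ℝ) :
    pderiv μ 0 x = 0 :=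
  pderiv_const μ 0 x

/-! ### Invariance under coordinate translations -/

section Translation

variable {ι : Type} [Fintype ι] [DecidableEq ι]

/-- The function `f` does not depend on the coordinate `κ`. -/
def IndependentOf (κ : ι) (f : (ι → ℝ) → ℝ) : Prop :=
  ∀ (t : ℝ) (x : ι → ℝ), f (x + t • Pi.single κ 1) = f x

theorem IndependentOf.pderiv_eq_zero {κ : ι} {f : (ι → ℝ) → ℝ} (hf : IndependentOf κ f)
    (x : ι → ℝ) : pderiv κ f x = 0 := by
  by_cases hd : DifferentiableAt ℝ f x
  · have h : lineDeriv ℝ f x (Pi.single κ 1) = 0 := by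
      simp only [lineDeriv, hf _ x, deriv_const]
    rw [pderiv, ← hd.lineDeriv_eq_fderiv, h]
  -- `fderiv` is `0` by convention here, so no smoothness is needed.
  · simp [pderiv, fderiv_zero_of_not_differentiableAt hd]

theorem IndependentOf.pderiv {κ : ι} {f : (ι → ℝ) → ℝ} (hf : IndependentOf κ f) (μ : ι) :
    IndependentOf κ (pderiv μ f) := by
  intro t x
  have h : (fun y => f (y + t • Pi.single κ 1)) = f := funext (hf t)
  rw [PlaneWave.pderiv, PlaneWave.pderiv, ← fderiv_comp_add_right, h]

end Translation

/-! ### The inverse metric and the Christoffel symbols -/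

section Metric

variable {m : ℕ} (H : ℝ → (Fin m → ℝ) → ℝ)

theorem ppMetric_inv (p : Coord m → ℝ) :
    (ppMetric H p)⁻¹ =
      Matrix.fromBlocks !![0, 1; 1, -H (p (Sum.inl 0)) (fun i => p (Sum.inr i))] 0 0 1 := by
  apply Matrix.inv_eq_right_inv
  rw [ppMetric, Matrix.fromBlocks_multiply, ← Matrix.fromBlocks_one]
  congr 1 <;> simp [Matrix.one_fin_two]

theorem ppMetric_apply_eq_const {σ ν : Coord m} (h : σ ≠ Sum.inl 0 ∨ ν ≠ Sum.inl 0) :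
    ∃ c : ℝ, (fun y => ppMetric H y σ ν) = fun _ => c := by
  rcases σ with σ | σ <;> rcases ν with ν | ν
  · fin_cases σ <;> fin_cases ν <;> simp_all [ppMetric] <;> exact ⟨_, rfl⟩
  all_goals exact ⟨_, rfl⟩

theorem independentOf_ppMetric (σ ν : Coord m) :
    IndependentOf (Sum.inl 1) (fun y => ppMetric H y σ ν) := by
  intro t x
  simp [ppMetric]

theorem independentOf_ppMetric_inv (σ ν : Coord m) :
    IndependentOf (Sum.inl 1) (fun y => (ppMetric H y)⁻¹ σ ν) := by
  intro t x
  simp [ppMetric_inv]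

theorem pderiv_ppMetric_eq_zero (μ : Coord m) {σ ν : Coord m}
    (h : σ ≠ Sum.inl 0 ∨ ν ≠ Sum.inl 0) (x : Coord m → ℝ) :
    pderiv μ (fun y => ppMetric H y σ ν) x = 0 := by
  obtain ⟨c, hc⟩ := ppMetric_apply_eq_const H h
  rw [hc, pderiv_const]

theorem ppMetric_inv_apply_eq_zero (p : Coord m → ℝ) {σ ν : Coord m}
    (hσ : σ = Sum.inl 0) (hν : ν ≠ Sum.inl 1) : (ppMetric H p)⁻¹ σ ν = 0 := by
  subst hσ
  rw [ppMetric_inv]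
  rcases ν with ν | ν
  · fin_cases ν <;> simp_all
  · rfl

theorem ppMetric_inv_comm (p : Coord m → ℝ) (σ ν : Coord m) :
    (ppMetric H p)⁻¹ σ ν = (ppMetric H p)⁻¹ ν σ := by
  have h : ((ppMetric H p)⁻¹).IsSymm := by
    rw [ppMetric_inv, Matrix.IsSymm, Matrix.fromBlocks_transpose]
    congr 1
    · ext i j; fin_cases i <;> fin_cases j <;> rfl
    · simp
  exact h.apply ν σ

/-- This says that `du` is parallel: `g^{uσ}` forces `σ = v`, where all three derivatives vanish. -/
theorem christoffel_up_u (μ ν : Coord m) :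
    christoffel (ppMetric H) (Sum.inl 0) μ ν = 0 := by
  funext x
  simp only [christoffel, Pi.zero_apply]
  rw [Finset.sum_eq_zero, mul_zero]
  intro σ _
  by_cases hσ : σ = Sum.inl 1
  · subst hσ
    rw [pderiv_ppMetric_eq_zero H μ (by simp), pderiv_ppMetric_eq_zero H ν (by simp),
      (independentOf_ppMetric H μ ν).pderiv_eq_zero]
    simp
  · rw [ppMetric_inv_apply_eq_zero H x rfl hσ, zero_mul]

theorem christoffel_comm (ρ μ ν : Coord m) :
    christoffel (ppMetric H) ρ μ ν = christoffel (ppMetric H) ρ ν μ := by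
  funext x
  simp only [christoffel]
  congr 1
  refine Finset.sum_congr rfl fun σ _ => ?_
  have h : pderiv σ (fun y => ppMetric H y μ ν) x = pderiv σ (fun y => ppMetric H y ν μ) x := by
    by_cases hu : μ = Sum.inl 0 ∧ ν = Sum.inl 0
    · rw [hu.1, hu.2]
    · rw [pderiv_ppMetric_eq_zero H σ (by tauto), pderiv_ppMetric_eq_zero H σ (by tauto)]
  rw [h]
  ring

/-- This says that `∂_v` is parallel. -/
theorem christoffel_low_v (ρ μ : Coord m) :
    christoffel (ppMetric H) ρ μ (Sum.inl 1) = 0 := by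
  funext x
  simp only [christoffel, Pi.zero_apply]
  rw [Finset.sum_eq_zero, mul_zero]
  intro σ _
  rw [pderiv_ppMetric_eq_zero H μ (by simp), pderiv_ppMetric_eq_zero H σ (by simp),
    (independentOf_ppMetric H σ μ).pderiv_eq_zero]
  simp

theorem christoffel_low_v_left (ρ ν : Coord m) :
    christoffel (ppMetric H) ρ (Sum.inl 1) ν = 0 := by
  rw [christoffel_comm, christoffel_low_v]

/-- Only derivatives of `g_{uu}` survive, and each metric entry in the formula carries `μ` or `ν`.
-/
theorem christoffel_low_ne_u (ρ : Coord m) {μ ν : Coord m} (hμ : μ ≠ Sum.inl 0)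
    (hν : ν ≠ Sum.inl 0) : christoffel (ppMetric H) ρ μ ν = 0 := by
  funext x
  simp only [christoffel, Pi.zero_apply]
  rw [Finset.sum_eq_zero, mul_zero]
  intro σ _
  rw [pderiv_ppMetric_eq_zero H μ (.inr hν), pderiv_ppMetric_eq_zero H ν (.inr hμ),
    pderiv_ppMetric_eq_zero H σ (.inl hμ)]
  simp

theorem independentOf_christoffel (ρ μ ν : Coord m) :
    IndependentOf (Sum.inl 1) (christoffel (ppMetric H) ρ μ ν) := by
  intro t x
  simp only [christoffel]
  congr 1
  refine Finset.sum_congr rfl fun σ _ => ?_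
  have h1 := independentOf_ppMetric_inv H ρ σ t x
  have h2 := (independentOf_ppMetric H σ ν).pderiv μ t x
  have h3 := (independentOf_ppMetric H σ μ).pderiv ν t x
  have h4 := (independentOf_ppMetric H μ ν).pderiv σ t x
  simp only at h1
  rw [h1, h2, h3, h4]

end Metric

/-! ### Index structure of the curvature and its derivatives -/

section Curvature

variable {m : ℕ} (H : ℝ → (Fin m → ℝ) → ℝ)

/-- A covariant tensor field that does not depend on `v` and all of whose nonzero components have
at least one index `u` and no index `v`. -/
structure IsNullAligned {k : ℕ} (T : TensorField (Coord m) k) : Prop where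
  independentOf : ∀ idx, IndependentOf (Sum.inl 1) (T idx)
  eq_zero_of_v : ∀ idx s, idx s = Sum.inl 1 → T idx = 0
  eq_zero_of_no_u : ∀ idx, (∀ s, idx s ≠ Sum.inl 0) → T idx = 0

theorem independentOf_riemannUp (ρ σ μ ν : Coord m) :
    IndependentOf (Sum.inl 1) (riemannUp (ppMetric H) ρ σ μ ν) := by
  intro t x
  simp only [riemannUp, independentOf_christoffel H _ _ _ t x,
    (independentOf_christoffel H ρ ν σ).pderiv μ t x,
    (independentOf_christoffel H ρ μ σ).pderiv ν t x]

theorem riemannUp_up_u (σ μ ν : Coord m) (x : Coord m → ℝ) :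
    riemannUp (ppMetric H) (Sum.inl 0) σ μ ν x = 0 := by
  simp [riemannUp, christoffel_up_u, pderiv_zero]

theorem riemannUp_eq_zero_of_v (ρ : Coord m) {σ μ ν : Coord m}
    (h : σ = Sum.inl 1 ∨ μ = Sum.inl 1 ∨ ν = Sum.inl 1) (x : Coord m → ℝ) :
    riemannUp (ppMetric H) ρ σ μ ν x = 0 := by
  rcases h with rfl | rfl | rfl
  · simp [riemannUp, christoffel_low_v, pderiv_zero]
  · simp [riemannUp, christoffel_low_v_left, pderiv_zero,
      (independentOf_christoffel H ρ ν σ).pderiv_eq_zero]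
  · simp [riemannUp, christoffel_low_v_left, pderiv_zero,
      (independentOf_christoffel H ρ μ σ).pderiv_eq_zero]

theorem riemannUp_eq_zero_of_ne_u (ρ : Coord m) {σ μ ν : Coord m} (hσ : σ ≠ Sum.inl 0)
    (hμ : μ ≠ Sum.inl 0) (hν : ν ≠ Sum.inl 0) (x : Coord m → ℝ) :
    riemannUp (ppMetric H) ρ σ μ ν x = 0 := by
  simp [riemannUp, christoffel_low_ne_u H _ hν hσ, christoffel_low_ne_u H _ hμ hσ, pderiv_zero]

theorem ppMetric_v_apply_eq_zero (p : Coord m → ℝ) {ν : Coord m} (hν : ν ≠ Sum.inl 0) :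
    ppMetric H p (Sum.inl 1) ν = 0 := by
  rcases ν with ν | ν
  · fin_cases ν <;> simp_all [ppMetric]
  · rfl

theorem isNullAligned_riemann : IsNullAligned (riemann (ppMetric H)) where
  independentOf idx t x := by
    simp only [riemann, independentOf_riemannUp H _ _ _ _ t x]
    exact Finset.sum_congr rfl fun l _ => by
      rw [show ppMetric H (x + t • Pi.single (Sum.inl 1) 1) (idx 0) l = ppMetric H x (idx 0) l from
        independentOf_ppMetric H (idx 0) l t x]
  eq_zero_of_v idx s hs := by
    funext x
    refine Finset.sum_eq_zero fun l _ => ?_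
    fin_cases s
    -- Lowering to `v` picks out `R^u`, which vanishes.
    · by_cases hl : l = Sum.inl 0
      · rw [hl, riemannUp_up_u, mul_zero]
      · rw [show idx 0 = Sum.inl 1 from hs, ppMetric_v_apply_eq_zero H x hl, zero_mul]
    · exact mul_eq_zero_of_right _ (riemannUp_eq_zero_of_v H l (.inl hs) x)
    · exact mul_eq_zero_of_right _ (riemannUp_eq_zero_of_v H l (.inr (.inl hs)) x)
    · exact mul_eq_zero_of_right _ (riemannUp_eq_zero_of_v H l (.inr (.inr hs)) x)
  eq_zero_of_no_u idx h := by
    funext x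
    refine Finset.sum_eq_zero fun l _ => ?_
    rw [riemannUp_eq_zero_of_ne_u H l (h 1) (h 2) (h 3), mul_zero]

/-- A Christoffel term may replace an index `u` by another one, but its symbol vanishes unless the
new index or the replaced one is `u`, so a `u` always remains. -/
theorem IsNullAligned.covDeriv {k : ℕ} {T : TensorField (Coord m) k} (hT : IsNullAligned T) :
    IsNullAligned (covDeriv (ppMetric H) T) where
  independentOf idx t x := by
    simp only [PlaneWave.covDeriv, (hT.independentOf _).pderiv _ t x,
      independentOf_christoffel H _ _ _ t x, hT.independentOf _ t x]
  eq_zero_of_v idx s hs := by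
    funext x
    simp only [PlaneWave.covDeriv, Pi.zero_apply]
    refine s.cases (motive := fun s => idx s = Sum.inl 1 → _) (fun h0 => ?_) (fun j hj => ?_) hs
    · simp [h0, christoffel_low_v_left, (hT.independentOf _).pderiv_eq_zero]
    · have hj' : Fin.tail idx j = Sum.inl 1 := hj
      rw [hT.eq_zero_of_v _ j hj', pderiv_zero, Finset.sum_eq_zero, sub_zero]
      refine fun i _ => Finset.sum_eq_zero fun l _ => ?_
      -- Either the symbol has the lower index `v`, or slot `j` of `T` keeps it.
      by_cases hij : j = i
      · rw [← hij, hj', christoffel_low_v, Pi.zero_apply, zero_mul]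
      · rw [hT.eq_zero_of_v _ j (by rw [Function.update_of_ne hij, hj']), Pi.zero_apply, mul_zero]
  eq_zero_of_no_u idx h := by
    funext x
    simp only [PlaneWave.covDeriv, Pi.zero_apply]
    rw [hT.eq_zero_of_no_u (Fin.tail idx) fun s => h s.succ, pderiv_zero, Finset.sum_eq_zero,
      sub_zero]
    refine fun i _ => Finset.sum_eq_zero fun l _ => ?_
    rw [christoffel_low_ne_u H l (h 0) (show Fin.tail idx i ≠ Sum.inl 0 from h i.succ), Pi.zero_apply, zero_mul]

theorem isNullAligned_nablaRiemann :
    ∀ p : ℕ, IsNullAligned (nablaRiemann (ppMetric H) p)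
  | 0 => isNullAligned_riemann H
  | p + 1 => (isNullAligned_nablaRiemann p).covDeriv H

/-- In a nonzero term of a full contraction, some index is `u`; its partner has to be `v`, since
`g^{uu} = g^{ui} = 0`, but no factor has a nonzero component with an index `v`. -/
theorem fullContraction_ppMetric (c : ContractionPattern) (x : Coord m → ℝ) :
    fullContraction (ppMetric H) c x = 0 := by
  refine Finset.sum_eq_zero fun idx _ => ?_
  by_contra hne
  obtain ⟨hR, hg⟩ := mul_ne_zero_iff.mp hne
  rw [Finset.prod_ne_zero_iff] at hR hg
  have hv : ∀ a, idx a ≠ Sum.inl 1 := fun a ha =>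
    hR a.1 (Finset.mem_univ _)
      (congrFun ((isNullAligned_nablaRiemann H _).eq_zero_of_v (fun s => idx ⟨a.1, s⟩) a.2 ha) x)
  have hu : ∀ a, idx a ≠ Sum.inl 0 := by
    intro a ha
    obtain ⟨⟨k, e⟩, rfl⟩ := c.pairing.symm.surjective a
    refine hg k (Finset.mem_univ _) ?_
    fin_cases e
    · exact ppMetric_inv_apply_eq_zero H x ha (hv _)
    · rw [ppMetric_inv_comm]
      exact ppMetric_inv_apply_eq_zero H x ha (hv _)
  exact hR ⟨0, c.r_pos⟩ (Finset.mem_univ _)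
    (congrFun ((isNullAligned_nablaRiemann H _).eq_zero_of_no_u _ fun s => hu ⟨_, s⟩) x)

theorem IsScalarCurvatureInvariant.eq_zero_of_ppMetric {J : (Coord m → ℝ) → ℝ}
    (hJ : IsScalarCurvatureInvariant (ppMetric H) J) : J = 0 := by
  -- The adjoined algebra is non-unital (no constant terms), so vanishing generators give the zero
  -- algebra.
  have h : Set.range (fullContraction (ppMetric H)) ⊆
      ((⊥ : NonUnitalSubalgebra ℝ ((Coord m → ℝ) → ℝ)) : Set ((Coord m → ℝ) → ℝ)) := by
    rintro _ ⟨c, rfl⟩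
    exact NonUnitalAlgebra.mem_bot.mpr (funext (fullContraction_ppMetric H c))
  exact NonUnitalAlgebra.mem_bot.mp (NonUnitalAlgebra.adjoin_le h hJ)

end Curvature

end PlaneWave

theorem theorem4p1 (m : ℕ) (g : PlaneWave.MetricField (PlaneWave.Coord m))
    (hg : PlaneWave.IsPlaneWave g ∨ PlaneWave.IsCovariantPlaneWave g)
    (J : (PlaneWave.Coord m → ℝ) → ℝ) (hJ : PlaneWave.IsScalarCurvatureInvariant g J) :
    ∀ x, J x = 0 := by
  obtain ⟨H, rfl⟩ : ∃ H, g = PlaneWave.ppMetric H := by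
    rcases hg with ⟨h, -, -, hg⟩ | ⟨⟨H, -, hg⟩, -⟩
    exacts [⟨_, hg⟩, ⟨H, hg⟩]
  exact congrFun hJ.eq_zero_of_ppMetric
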